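/- Let $d\ge 1$, $k\ge 0$ be integers with $k\le d^2$, and let $\epsilon>0$. Let $\mathcal{E}=\{p_i,U_i\}_{i=1}^N$ be a finite ensemble of unitaries in $U(d)$ ($p_i\ge 0$, $\sum_i p_i=1$) that is an $\epsilon$-approximate unitary $k$-design, i.e. the twirls $$\mathcal{T}^{(k)}_{\mathcal{E}}(X)=\sum_{i=1}^N p_i\,U_i^{\otimes k}X(U_i^\dagger)^{\otimes k},\qquad \mathcal{T}^{(k)}_{U}(X)=\int_{U(d)} U^{\otimes k}X(U^\dagger)^{\otimes k}\,dU$$ (with $dU$ the normalized Haar measure) satisfy $$\big\|\mathcal{T}^{(k)}_{\mathcal{E}}-\mathcal{T}^{(k)}_{U}\big\|_\diamond\le \frac{k!}{d^{2k}}\,\epsilon .$$ Let $|x\rangle\in\mathbb{C}^d$ be a unit vector, and let $|y_1\rangle,\dots,|y_{N'}\rangle$ be the distinct states among $U_1|x\rangle,\dots,U_N|x\rangle$, where unit vectors that differ only by a global phase are the same state. The weight $q_j$ of $|y_j\rangle$ is the sum of all $p_i$ for which $U_i|x\rangle$ is the state $|y_j\rangle$. Then $$\max_{1\le j\le N'}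 q_j\le (1+\epsilon)\binom{d+k-1}{k}^{-1}\qquad\text{and}\qquad N'\ge \frac{1}{1+\epsilon}\binom{d+k-1}{k}.$$ -/

import Mathlib

open MeasureTheory
open scoped ENNReal Nat

noncomputable section

namespace QuantumDesign

/-- The unitary group `U(d)`. -/
abbrev U (d : ℕ) : Type := Matrix.unitaryGroup (Fin d) ℂ

/-- The computational basis of the `k`-fold tensor power of `ℂ^d`. -/
abbrev Idx (d k : ℕ) : Type := Fin k → Fin d

/-! ### Haar measure on the unitary group -/

instance instCompactSpaceU (d : ℕ) : CompactSpace (U d) := by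
  have hclosed : IsClosed (Matrix.unitaryGroup (Fin d) ℂ : Set (Matrix (Fin d) (Fin d) ℂ)) :=
    isClosed_unitary
  have hK : IsCompact (Set.pi Set.univ fun _ : Fin d => Set.pi Set.univ fun _ : Fin d =>
      Metric.closedBall (0 : ℂ) 1) :=
    isCompact_univ_pi fun _ => isCompact_univ_pi fun _ => isCompact_closedBall _ _
  refine isCompact_iff_compactSpace.mp (hK.of_isClosed_subset hclosed ?_)
  intro A hA i _ j _
  simpa using entry_norm_bound_of_unitary hA i j

instance instMeasurableSpaceU (d : ℕ) : MeasurableSpace (U d) := borel (U d)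

instance instBorelSpaceU (d : ℕ) : BorelSpace (U d) := ⟨rfl⟩

/-- The Haar measure on `U(d)`, normalized to total mass one. -/
def haarU (d : ℕ) : Measure (U d) := Measure.haarMeasure ⊤

instance instIsProbabilityMeasureHaarU (d : ℕ) : IsProbabilityMeasure (haarU d) :=
  ⟨Measure.haarMeasure_self⟩

/-! ### Twirling channels -/

/-- The `k`-fold tensor power `A^{⊗k}`, as a matrix in the computational basis. -/
def tensorPow {d : ℕ} (k : ℕ) (A : Matrix (Fin d) (Fin d) ℂ) :
    Matrix (Idx d k) (Idx d k) ℂ :=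
  Matrix.of fun a b => ∏ l, A (a l) (b l)

/-- The channel `X ↦ U^{⊗k} X (U†)^{⊗k}`. -/
def conjChannel {d : ℕ} (k : ℕ) (u : U d) :
    Matrix (Idx d k) (Idx d k) ℂ →ₗ[ℂ] Matrix (Idx d k) (Idx d k) ℂ where
  toFun X := tensorPow k (u : Matrix (Fin d) (Fin d) ℂ) * X *
    tensorPow k (star (u : Matrix (Fin d) (Fin d) ℂ))
  map_add' X Y := by rw [mul_add, add_mul]
  map_smul' c X := by simp

theorem continuous_conjChannel_apply {d k : ℕ} (X : Matrix (Idx d k) (Idx d k) ℂ)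
    (a b : Idx d k) : Continuous fun u : U d => conjChannel k u X a b := by
  have hc : ∀ i j : Fin d, Continuous fun u : U d => (u : Matrix (Fin d) (Fin d) ℂ) i j :=
    fun i j => continuous_subtype_val.matrix_elem i j
  simp only [conjChannel, tensorPow, LinearMap.coe_mk, AddHom.coe_mk, Matrix.mul_apply,
    Matrix.of_apply, Matrix.star_apply]
  exact continuous_finsetSum _ fun j _ => ((continuous_finsetSum _ fun i _ =>
    ((continuous_finsetProd _ fun l _ => hc _ _).mul continuous_const))).mul
      (continuous_finsetProd _ fun l _ => (hc _ _).star)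

theorem integrable_conjChannel_apply {d k : ℕ} (X : Matrix (Idx d k) (Idx d k) ℂ)
    (a b : Idx d k) : Integrable (fun u : U d => conjChannel k u X a b) (haarU d) :=
  (continuous_conjChannel_apply X a b).integrable_of_hasCompactSupport
    (HasCompactSupport.of_compactSpace _)

/-- The `k`-fold twirl over the full unitary group, `X ↦ ∫ dU U^{⊗k} X (U†)^{⊗k}`; the
matrix-valued integral is taken entry by entry. -/
def haarTwirl (d k : ℕ) :
    Matrix (Idx d k) (Idx d k) ℂ →ₗ[ℂ] Matrix (Idx d k) (Idx d k) ℂ where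
  toFun X := Matrix.of fun a b => ∫ u, conjChannel k u X a b ∂haarU d
  map_add' X Y := by
    ext a b
    simp only [map_add, Matrix.add_apply, Matrix.of_apply]
    exact integral_add (integrable_conjChannel_apply X a b) (integrable_conjChannel_apply Y a b)
  map_smul' c X := by
    ext a b
    simp only [map_smul, Matrix.smul_apply, Matrix.of_apply, RingHom.id_apply]
    exact integral_smul c _

/-- A finite ensemble `{p_i, U_i}`, `i = 1, …, N`, of unitaries: `U_i` occurs with
probability `p_i`. -/
structure UnitaryEnsemble (d N : ℕ) where
  p : Fin N → ℝ
  p_nonneg : ∀ i, 0 ≤ p i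
  p_sum : ∑ i, p i = 1
  u : Fin N → U d

/-- The `k`-fold twirl over an ensemble, `X ↦ ∑ i, p_i U_i^{⊗k} X (U_i†)^{⊗k}`. -/
def UnitaryEnsemble.twirl {d N : ℕ} (E : UnitaryEnsemble d N) (k : ℕ) :
    Matrix (Idx d k) (Idx d k) ℂ →ₗ[ℂ] Matrix (Idx d k) (Idx d k) ℂ :=
  ∑ i, (E.p i : ℂ) • conjChannel k (E.u i)

/-! ### Trace norm and diamond norm -/

/-- The trace norm `‖X‖₁ = Tr √(X† X)`, i.e. the sum of the singular values of `X`. -/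
def traceNorm {n : Type*} [Fintype n] [DecidableEq n] (X : Matrix n n ℂ) : ℝ :=
  ∑ i, √((Matrix.isHermitian_conjTranspose_mul_self X).eigenvalues i)

/-- The map `Φ ⊗ id`, with an ancilla of the same dimension as the system. -/
def ampliate {n : Type*} (Φ : Matrix n n ℂ →ₗ[ℂ] Matrix n n ℂ) (X : Matrix (n × n) (n × n) ℂ) :
    Matrix (n × n) (n × n) ℂ :=
  Matrix.of fun a b => Φ (Matrix.of fun i j => X (i, a.2) (j, b.2)) a.1 b.1

/-- The diamond norm `‖Φ‖_⋄ = sup {‖(Φ ⊗ id)(X)‖₁ : ‖X‖₁ ≤ 1}`; the supremum is taken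
in `[0, ∞]`. -/
def diamondNorm {n : Type*} [Fintype n] [DecidableEq n]
    (Φ : Matrix n n ℂ →ₗ[ℂ] Matrix n n ℂ) : ℝ≥0∞ :=
  ⨆ (X : Matrix (n × n) (n × n) ℂ) (_ : traceNorm X ≤ 1), ENNReal.ofReal (traceNorm (ampliate Φ X))

/-- An `ε`-approximate unitary `k`-design:
`‖T_E^{(k)} - T_U^{(k)}‖_⋄ ≤ (k! / d^{2k}) ε`. -/
def UnitaryEnsemble.IsApproxDesign {d N : ℕ} (E : UnitaryEnsemble d N) (k : ℕ) (ε : ℝ) : Prop :=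
  diamondNorm (E.twirl k - haarTwirl d k) ≤ ENNReal.ofReal ((k ! : ℝ) / (d : ℝ) ^ (2 * k) * ε)

/-! ### Orbits -/

/-- The pure state `|ψ⟩⟨ψ|` of a vector `ψ`. Two unit vectors describe the same state, i.e. differ
by a global phase, if and only if these projectors agree. -/
def pureState {d : ℕ} (ψ : Fin d → ℂ) : Matrix (Fin d) (Fin d) ℂ :=
  Matrix.vecMulVec ψ (star ψ)

/-- The state of `U_i |x⟩`. -/
def UnitaryEnsemble.orbitState {d N : ℕ} (E : UnitaryEnsemble d N)
    (x : EuclideanSpace ℂ (Fin d)) (i : Fin N) : Matrix (Fin d) (Fin d) ℂ :=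
  pureState ((E.u i : Matrix (Fin d) (Fin d) ℂ).mulVec x.ofLp)

open Classical in
/-- The distinct states in the orbit of `x` under the ensemble. -/
def UnitaryEnsemble.orbitStates {d N : ℕ} (E : UnitaryEnsemble d N)
    (x : EuclideanSpace ℂ (Fin d)) : Finset (Matrix (Fin d) (Fin d) ℂ) :=
  Finset.univ.image (E.orbitState x)

open Classical in
/-- The weight of a state `ρ` in the orbit of `x`: the total probability of all `U_i` that map
`x` to `ρ`. -/
def UnitaryEnsemble.orbitWeight {d N : ℕ} (E : UnitaryEnsemble d N)
    (x : EuclideanSpace ℂ (Fin d)) (ρ : Matrix (Fin d) (Fin d) ℂ) : ℝ :=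
  ∑ i with E.orbitState x i = ρ, E.p i

end QuantumDesign

end

open MeasureTheory
open scoped ENNReal Nat

noncomputable section

namespace QuantumDesign

/-! ### Trace norm -/

/-! Apply both twirls to the projector onto `x^{⊗k}` and take the diagonal matrix element at
`y^{⊗k}`, where `y = U_i x` represents a state of the orbit. The ensemble gives `∑ p_i |⟨y, U_i
x⟩|^{2k}`, which is at least the weight of `y`, since every unitary reaching that state has overlap
one (`orbitWeight_le_sum`). The Haar twirl gives exactly the inverse of `(d+k-1).choose k`
(`choose_mul_integral_norm_dotProduct_pow`). The two differ by at most the diamond norm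
(`norm_dotProduct_mulVec_le_diamondNorm`), and for `k ≤ d^2` the prefactor `k!/d^{2k}` is at most
that inverse binomial (`factorial_mul_choose_le`). This bounds each weight; as the weights sum to
one, it also bounds the number of states from below.

The Haar moment is found by a recursion in `k`, without representation theory: invariance under
plane rotations, differentiated at angle zero, relates mixed moments of two coordinates to pure
ones, and `∑ |z_j|^2 = 1` closes the recursion. -/

theorem star_dotProduct_self {n : Type*} [Fintype n] (v : n → ℂ) :
    star v ⬝ᵥ v = ((∑ i, ‖v i‖ ^ 2 : ℝ) : ℂ) := by
  simp only [dotProduct, Pi.star_apply, Complex.ofReal_sum, Complex.ofReal_pow, ← Complex.conj_mul',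
    starRingEnd_apply]

theorem norm_star_dotProduct_sq_le {n : Type*} [Fintype n] (v w : n → ℂ) :
    ‖star v ⬝ᵥ w‖ ^ 2 ≤ (∑ i, ‖v i‖ ^ 2) * ∑ i, ‖w i‖ ^ 2 := by
  have h := norm_inner_le_norm (𝕜 := ℂ) (WithLp.toLp 2 v) (WithLp.toLp 2 w)
  rw [EuclideanSpace.inner_toLp_toLp, dotProduct_comm] at h
  calc _ ≤ (‖WithLp.toLp 2 v‖ * ‖WithLp.toLp 2 w‖) ^ 2 := by gcongr
    _ = _ := by rw [mul_pow, EuclideanSpace.norm_sq_eq, EuclideanSpace.norm_sq_eq]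

open scoped ComplexOrder in
-- Cauchy–Schwarz reduces this to `‖A v‖`. In the eigenbasis of `A† A`, `‖A v‖²` is an average of
-- squared singular values, each at most the square of their sum.
theorem norm_dotProduct_mulVec_le_traceNorm {n : Type*} [Fintype n] [DecidableEq n]
    (A : Matrix n n ℂ) (v : n → ℂ) (hv : star v ⬝ᵥ v = 1) :
    ‖star v ⬝ᵥ A.mulVec v‖ ≤ traceNorm A := by
  unfold traceNorm
  set H := Matrix.isHermitian_conjTranspose_mul_self A
  set V : Matrix n n ℂ := (H.eigenvectorUnitary : Matrix n n ℂ) with hV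
  set w := (star V).mulVec v with hw
  have hlam : ∀ i, 0 ≤ H.eigenvalues i :=
    (Matrix.posSemidef_conjTranspose_mul_self A).eigenvalues_nonneg
  have hww : ∑ i, ‖w i‖ ^ 2 = 1 := by
    have : star w ⬝ᵥ w = 1 := by
      rw [hw, Matrix.star_mulVec, ← Matrix.dotProduct_mulVec, Matrix.mulVec_mulVec,
        Matrix.star_eq_conjTranspose, Matrix.conjTranspose_conjTranspose,
        ← Matrix.star_eq_conjTranspose, hV, ← Unitary.coe_star, Unitary.coe_mul_star_self, Matrix.one_mulVec, hv]
    rw [star_dotProduct_self] at this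
    exact_mod_cast this
  have hvv : ∑ i, ‖v i‖ ^ 2 = 1 := by
    rw [star_dotProduct_self] at hv
    exact_mod_cast hv
  have hAv : ∑ i, ‖A.mulVec v i‖ ^ 2 = ∑ i, H.eigenvalues i * ‖w i‖ ^ 2 := by
    have h1 : star (A.mulVec v) ⬝ᵥ A.mulVec v =
        star w ⬝ᵥ (Matrix.diagonal (RCLike.ofReal ∘ H.eigenvalues)).mulVec w := by
      rw [Matrix.star_mulVec, ← Matrix.dotProduct_mulVec, Matrix.mulVec_mulVec]
      nth_rewrite 1 [H.spectral_theorem]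
      rw [Unitary.conjStarAlgAut_apply, hw, Matrix.star_mulVec, ← Matrix.dotProduct_mulVec,
        Matrix.mulVec_mulVec, Matrix.mulVec_mulVec, Matrix.star_eq_conjTranspose,
        Matrix.conjTranspose_conjTranspose, Matrix.mul_assoc]
    have h2 : star w ⬝ᵥ (Matrix.diagonal (RCLike.ofReal ∘ H.eigenvalues)).mulVec w =
        ((∑ i, H.eigenvalues i * ‖w i‖ ^ 2 : ℝ) : ℂ) := by
      simp only [dotProduct, Matrix.mulVec_diagonal, Pi.star_apply, Complex.ofReal_sum,
        Complex.ofReal_mul, Complex.ofReal_pow, ← Complex.conj_mul', starRingEnd_apply,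
        Function.comp_apply, Complex.coe_algebraMap]
      exact Finset.sum_congr rfl fun i _ => by ring
    rw [star_dotProduct_self, h2] at h1
    exact_mod_cast h1
  have hS : ∀ i, H.eigenvalues i ≤ (∑ j, √(H.eigenvalues j)) ^ 2 := fun i => by
    calc H.eigenvalues i = √(H.eigenvalues i) ^ 2 := (Real.sq_sqrt (hlam i)).symm
      _ ≤ _ := by
        gcongr
        exact Finset.single_le_sum (f := fun j => √(H.eigenvalues j))
          (fun j _ => Real.sqrt_nonneg _) (Finset.mem_univ i)
  refine (sq_le_sq₀ (norm_nonneg _) (Finset.sum_nonneg fun i _ => Real.sqrt_nonneg _)).1 ?_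
  calc ‖star v ⬝ᵥ A.mulVec v‖ ^ 2 ≤ _ := norm_star_dotProduct_sq_le _ _
    _ = ∑ i, H.eigenvalues i * ‖w i‖ ^ 2 := by rw [hvv, one_mul, hAv]
    _ ≤ ∑ i, (∑ j, √(H.eigenvalues j)) ^ 2 * ‖w i‖ ^ 2 :=
      Finset.sum_le_sum fun i _ => mul_le_mul_of_nonneg_right (hS i) (sq_nonneg _)
    _ = _ := by rw [← Finset.mul_sum, hww, mul_one]

theorem _root_.Matrix.IsHermitian.eigenvalues_mul_self_of_isIdempotentElem {n : Type*} [Fintype n]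
    [DecidableEq n] {M : Matrix n n ℂ} (H : M.IsHermitian) (hM : M * M = M) (i : n) :
    H.eigenvalues i * H.eigenvalues i = H.eigenvalues i := by
  have h1 := H.mulVec_eigenvectorBasis i
  have h2 : M.mulVec (M.mulVec (H.eigenvectorBasis i)) = M.mulVec (H.eigenvectorBasis i) := by
    rw [Matrix.mulVec_mulVec, hM]
  rw [h1, Matrix.mulVec_smul, h1, smul_smul] at h2
  have hne : (⇑(H.eigenvectorBasis i) : n → ℂ) ≠ 0 := fun h => by
    have h3 := H.eigenvectorBasis.toBasis.ne_zero i
    rw [OrthonormalBasis.coe_toBasis] at h3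
    exact h3 (PiLp.ext fun j => congrFun h j)
  exact smul_left_injective ℝ hne h2

/-- For a projection, `M† M = M` has eigenvalues fixed by squaring, so taking square roots changes
nothing and the sum is the trace. -/
theorem traceNorm_of_isHermitian_of_isIdempotentElem {n : Type*} [Fintype n] [DecidableEq n]
    {M : Matrix n n ℂ} (h1 : M.IsHermitian) (h2 : M * M = M) : (traceNorm M : ℂ) = M.trace := by
  have hP : M.conjTranspose * M = M := by rw [h1.eq, h2]
  unfold traceNorm
  have H := Matrix.isHermitian_conjTranspose_mul_self M
  have key : ∀ i, √(H.eigenvalues i) = H.eigenvalues i := by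
    intro i
    have h1 := H.eigenvalues_mul_self_of_isIdempotentElem (by rw [hP, h2]) i
    have h2 : 0 ≤ H.eigenvalues i := by rw [← h1]; exact mul_self_nonneg _
    rw [Real.sqrt_eq_iff_mul_self_eq h2 h2, h1]
  rw [Finset.sum_congr rfl fun i _ => key i]
  have h := H.trace_eq_sum_eigenvalues
  rw [← congrArg Matrix.trace hP, h, Complex.ofReal_sum]
  rfl

theorem traceNorm_vecMulVec_self {n : Type*} [Fintype n] [DecidableEq n]
    (v : n → ℂ) (hv : star v ⬝ᵥ v = 1) : traceNorm (Matrix.vecMulVec v (star v)) = 1 := by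
  have h := traceNorm_of_isHermitian_of_isIdempotentElem (M := Matrix.vecMulVec v (star v))
    (by rw [Matrix.IsHermitian, Matrix.conjTranspose_vecMulVec, star_star])
    (by rw [Matrix.vecMulVec_mul_vecMulVec, hv, one_smul])
  rw [Matrix.trace_vecMulVec, dotProduct_comm, hv] at h
  exact_mod_cast h

/-! ### Combinatorics -/

/-- The left side is `∏ (d + i)` over `i < k`. In its square, pair factor `i` with factor `j = k - 1
- i`; each pair has product at most `d^4`. -/
theorem factorial_mul_choose_le {d k : ℕ} (hk : k ≤ d ^ 2) :
    k ! * (d + k - 1).choose k ≤ d ^ (2 * k) := by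
  have h1 : k ! * (d + k - 1).choose k = ∏ i ∈ Finset.range k, (d + i) := by
    rw [← Nat.descFactorial_eq_factorial_mul_choose, Nat.add_descFactorial_eq_ascFactorial',
      Nat.ascFactorial_eq_prod_range]
  have h2 : (∏ i ∈ Finset.range k, (d + i)) ^ 2 ≤ (d ^ (2 * k)) ^ 2 := by
    calc (∏ i ∈ Finset.range k, (d + i)) ^ 2
        = ∏ i ∈ Finset.range k, ((d + i) * (d + (k - 1 - i))) := by
          rw [Finset.prod_mul_distrib, Finset.prod_range_reflect (fun i => d + i), sq]
      _ ≤ ∏ i ∈ Finset.range k, d ^ 4 := by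
          refine Finset.prod_le_prod' fun i hi => ?_
          have hi' := Finset.mem_range.1 hi
          obtain ⟨j, hj⟩ : ∃ j, k - 1 - i = j := ⟨_, rfl⟩
          have hij : i + j + 1 ≤ d ^ 2 := by omega
          rw [hj]
          -- Since `i + j ≤ d^2 - 1`, this comes down to `(d - 1)^2 ≥ 0`. AM-GM then bounds `(d + i)
          -- * (d + j)` by `d^4`.
          have h4 : (2 * d + i + j) ≤ 2 * d ^ 2 := by
            zify at *
            nlinarith [sq_nonneg ((d : ℤ) - 1)]
          zify at *
          nlinarith [sq_nonneg ((i : ℤ) - j)]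
      _ = (d ^ (2 * k)) ^ 2 := by
          rw [Finset.prod_const, Finset.card_range, ← pow_mul, ← pow_mul]; ring_nf
  rw [h1]
  exact (Nat.pow_le_pow_iff_left two_ne_zero).1 h2

/-! ### Tensor powers of vectors -/

/-- The `k`-fold tensor power `v^{⊗k}` of a vector in the computational basis. -/
def vecPow {d : ℕ} (k : ℕ) (v : Fin d → ℂ) : Idx d k → ℂ := fun a => ∏ l, v (a l)

theorem tensorPow_mulVec_vecPow {d k : ℕ} (A : Matrix (Fin d) (Fin d) ℂ) (v : Fin d → ℂ) :
    (tensorPow k A).mulVec (vecPow k v) = vecPow k (A.mulVec v) := by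
  ext a
  simp only [Matrix.mulVec, dotProduct, vecPow, tensorPow, Matrix.of_apply,
    ← Finset.prod_mul_distrib]
  rw [Finset.prod_univ_sum, Fintype.piFinset_univ]

theorem star_vecPow_dotProduct_vecPow {d k : ℕ} (v w : Fin d → ℂ) :
    star (vecPow k v) ⬝ᵥ vecPow k w = (star v ⬝ᵥ w) ^ k := by
  simp only [dotProduct, vecPow, Pi.star_apply, star_prod, ← Finset.prod_mul_distrib]
  rw [← Fin.prod_const, Finset.prod_univ_sum, Fintype.piFinset_univ]

theorem tensorPow_star {d k : ℕ} (A : Matrix (Fin d) (Fin d) ℂ) :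
    tensorPow k (star A) = (tensorPow k A).conjTranspose := by
  ext a b
  simp [tensorPow, Matrix.star_apply, Matrix.conjTranspose_apply]

theorem dotProduct_vecMulVec_star_mulVec {n : Type*} [Fintype n] (v w : n → ℂ) :
    star v ⬝ᵥ (Matrix.vecMulVec w (star w)).mulVec v = ((‖star v ⬝ᵥ w‖ ^ 2 : ℝ) : ℂ) := by
  have h : star w ⬝ᵥ v = star (star v ⬝ᵥ w) := Matrix.star_dotProduct _ _
  rw [Matrix.vecMulVec_mulVec, dotProduct_smul, h, op_smul_eq_mul, Complex.star_def,
    Complex.mul_conj']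
  push_cast
  rfl

theorem conjChannel_vecPow {d k : ℕ} (u : U d) (v : Fin d → ℂ) :
    conjChannel k u (Matrix.vecMulVec (vecPow k v) (star (vecPow k v))) =
      Matrix.vecMulVec (vecPow k ((u : Matrix (Fin d) (Fin d) ℂ).mulVec v))
        (star (vecPow k ((u : Matrix (Fin d) (Fin d) ℂ).mulVec v))) := by
  simp only [conjChannel, LinearMap.coe_mk, AddHom.coe_mk]
  rw [tensorPow_star, Matrix.mul_vecMulVec, Matrix.vecMulVec_mul, ← Matrix.star_mulVec,
    tensorPow_mulVec_vecPow]

theorem dotProduct_conjChannel_mulVec {d k : ℕ} (u : U d) (v w : Fin d → ℂ) :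
    star (vecPow k w) ⬝ᵥ (conjChannel k u
      (Matrix.vecMulVec (vecPow k v) (star (vecPow k v)))).mulVec (vecPow k w) =
      ((‖star w ⬝ᵥ (u : Matrix (Fin d) (Fin d) ℂ).mulVec v‖ ^ (2 * k) : ℝ) : ℂ) := by
  rw [conjChannel_vecPow, dotProduct_vecMulVec_star_mulVec, star_vecPow_dotProduct_vecPow,
    norm_pow, ← pow_mul, mul_comm]

theorem dotProduct_twirl_mulVec {d k N : ℕ} (E : UnitaryEnsemble d N) (v w : Fin d → ℂ) :
    star (vecPow k w) ⬝ᵥ (E.twirl k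
      (Matrix.vecMulVec (vecPow k v) (star (vecPow k v)))).mulVec (vecPow k w) =
      ((∑ i, E.p i * ‖star w ⬝ᵥ (E.u i : Matrix (Fin d) (Fin d) ℂ).mulVec v‖ ^ (2 * k) : ℝ) :
        ℂ) := by
  simp only [UnitaryEnsemble.twirl, LinearMap.sum_apply, LinearMap.smul_apply, Matrix.sum_mulVec,
    dotProduct_sum, Matrix.smul_mulVec, dotProduct_smul, dotProduct_conjChannel_mulVec]
  push_cast
  simp

theorem dotProduct_haarTwirl_mulVec {d k : ℕ} (v w : Fin d → ℂ) :
    star (vecPow k w) ⬝ᵥ (haarTwirl d k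
      (Matrix.vecMulVec (vecPow k v) (star (vecPow k v)))).mulVec (vecPow k w) =
      ((∫ u : U d, ‖star w ⬝ᵥ (u : Matrix (Fin d) (Fin d) ℂ).mulVec v‖ ^ (2 * k) ∂haarU d : ℝ) :
        ℂ) := by
  rw [← integral_complex_ofReal]
  simp only [← dotProduct_conjChannel_mulVec]
  simp only [haarTwirl, LinearMap.coe_mk, AddHom.coe_mk, Matrix.mulVec, dotProduct, Matrix.of_apply]
  have hI := fun a b => integrable_conjChannel_apply
    (Matrix.vecMulVec (vecPow k v) (star (vecPow k v))) a b
  rw [integral_finsetSum _ fun a _ => (integrable_finsetSum _ fun b _ =>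
    (hI a b).mul_const _).const_mul _]
  refine Finset.sum_congr rfl fun a _ => ?_
  rw [integral_const_mul, integral_finsetSum _ fun b _ => (hI a b).mul_const _]
  simp only [integral_mul_const]

/-! ### The diamond norm bounds diagonal matrix elements -/

theorem norm_dotProduct_mulVec_le_diamondNorm {n : Type*} [Fintype n] [DecidableEq n]
    (Φ : Matrix n n ℂ →ₗ[ℂ] Matrix n n ℂ) (v w : n → ℂ) (hv : star v ⬝ᵥ v = 1)
    (hw : star w ⬝ᵥ w = 1) :
    ENNReal.ofReal ‖star w ⬝ᵥ (Φ (Matrix.vecMulVec v (star v))).mulVec w‖ ≤ diamondNorm Φ := by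
  have prod_dot : ∀ a b : n → ℂ, star a ⬝ᵥ a = 1 → star b ⬝ᵥ b = 1 →
      star (fun p : n × n => a p.1 * b p.2) ⬝ᵥ (fun p : n × n => a p.1 * b p.2) = 1 := by
    intro a b ha hb
    calc _ = (star a ⬝ᵥ a) * (star b ⬝ᵥ b) := by
          simp only [dotProduct, Fintype.sum_prod_type, Finset.sum_mul_sum, Pi.star_apply, star_mul']
          exact Finset.sum_congr rfl fun i _ => Finset.sum_congr rfl fun j _ => by ring
      _ = 1 := by rw [ha, hb, one_mul]
  -- The second factor is the ancilla. Any unit vector would do there; the same one in `V` and `W`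
  -- makes it contribute only a factor one.
  set V : n × n → ℂ := fun p => v p.1 * v p.2 with hV
  set W : n × n → ℂ := fun p => w p.1 * v p.2 with hW
  have hVV := prod_dot v v hv hv
  have hWW := prod_dot w v hw hv
  have hamp : ampliate Φ (Matrix.vecMulVec V (star V)) =
      Matrix.of fun a b => v a.2 * star (v b.2) * Φ (Matrix.vecMulVec v (star v)) a.1 b.1 := by
    ext a b
    have : (Matrix.of fun i j => Matrix.vecMulVec V (star V) (i, a.2) (j, b.2)) =
        (v a.2 * star (v b.2)) • Matrix.vecMulVec v (star v) := by
      ext i j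
      simp [Matrix.vecMulVec_apply, hV]
      ring
    simp [ampliate, this]
  have hquad : star W ⬝ᵥ (ampliate Φ (Matrix.vecMulVec V (star V))).mulVec W =
      star w ⬝ᵥ (Φ (Matrix.vecMulVec v (star v))).mulVec w := by
    rw [hamp]
    generalize Φ (Matrix.vecMulVec v (star v)) = M
    calc _ = (star w ⬝ᵥ M.mulVec w) * (star v ⬝ᵥ v) * (star v ⬝ᵥ v) := by
          have inner : ∀ i a, ∑ j, ∑ b, v a * star (v b) * M i j * (w j * v b) =
              v a * (∑ j, M i j * w j) * (star v ⬝ᵥ v) := by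
            intro i a
            simp only [dotProduct, Finset.mul_sum, Finset.sum_mul, Pi.star_apply]
            rw [Finset.sum_comm]
            exact Finset.sum_congr rfl fun b _ => Finset.sum_congr rfl fun j _ => by ring
          simp only [dotProduct, Matrix.mulVec, Fintype.sum_prod_type, Pi.star_apply, hW,
            star_mul', Matrix.of_apply] at inner ⊢
          simp only [inner]
          simp only [← mul_assoc, ← Finset.sum_mul]
          congr 1
          rw [Finset.sum_mul_sum]
          refine Finset.sum_congr rfl fun i _ => ?_
          rw [Finset.sum_mul, Finset.mul_sum]
          refine Finset.sum_congr rfl fun a _ => ?_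
          simp only [mul_assoc, ← Finset.mul_sum]
          ring
      _ = _ := by rw [hv, mul_one, mul_one]
  rw [← hquad]
  refine le_trans (ENNReal.ofReal_le_ofReal (norm_dotProduct_mulVec_le_traceNorm _ W hWW)) ?_
  exact le_iSup₂ (f := fun (X : Matrix (n × n) (n × n) ℂ) (_ : traceNorm X ≤ 1) =>
    ENNReal.ofReal (traceNorm (ampliate Φ X))) _ (traceNorm_vecMulVec_self V hVV).le

/-! ### Moments of a Haar random vector -/

instance instIsMulLeftInvariantHaarU (d : ℕ) : (haarU d).IsMulLeftInvariant :=
  inferInstanceAs (Measure.haarMeasure _).IsMulLeftInvariant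

/-- The vector `u x`. -/
def orbitVec {d : ℕ} (x : Fin d → ℂ) (u : U d) : Fin d → ℂ :=
  (u : Matrix (Fin d) (Fin d) ℂ).mulVec x

theorem continuous_orbitVec {d : ℕ} (x : Fin d → ℂ) : Continuous (orbitVec x) :=
  continuous_subtype_val.matrix_mulVec continuous_const

theorem orbitVec_mul {d : ℕ} (x : Fin d → ℂ) (w u : U d) :
    orbitVec x (w * u) = (w : Matrix (Fin d) (Fin d) ℂ).mulVec (orbitVec x u) := by
  simp [orbitVec, Matrix.mulVec_mulVec]

theorem star_dotProduct_unitary_mulVec {d : ℕ} (u : U d) (v w : Fin d → ℂ) :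
    star ((u : Matrix (Fin d) (Fin d) ℂ).mulVec v) ⬝ᵥ (u : Matrix (Fin d) (Fin d) ℂ).mulVec w =
      star v ⬝ᵥ w := by
  rw [Matrix.star_mulVec, ← Matrix.dotProduct_mulVec, Matrix.mulVec_mulVec,
    ← Matrix.star_eq_conjTranspose, Unitary.coe_star_mul_self, Matrix.one_mulVec]

theorem integral_comp_mulVec_orbitVec {d : ℕ} (x : Fin d → ℂ) (w : U d) (f : (Fin d → ℂ) → ℂ) :
    ∫ u, f ((w : Matrix (Fin d) (Fin d) ℂ).mulVec (orbitVec x u)) ∂haarU d =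
      ∫ u, f (orbitVec x u) ∂haarU d := by
  simp only [← orbitVec_mul]
  exact integral_mul_left_eq_self (fun u => f (orbitVec x u)) w

theorem integrable_comp_orbitVec {d : ℕ} {E : Type*} [NormedAddCommGroup E] (x : Fin d → ℂ)
    {f : (Fin d → ℂ) → E} (hf : Continuous f) :
    Integrable (fun u => f (orbitVec x u)) (haarU d) :=
  (hf.comp (continuous_orbitVec x)).integrable_of_hasCompactSupport
    (HasCompactSupport.of_compactSpace _)

/-- The diagonal unitary that multiplies the `j`-th coordinate by `I`. -/
def phase {d : ℕ} (j : Fin d) : U d :=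
  ⟨Matrix.diagonal (Function.update 1 j Complex.I), by
    rw [Matrix.mem_unitaryGroup_iff, Matrix.star_eq_conjTranspose, Matrix.diagonal_conjTranspose,
      Matrix.diagonal_mul_diagonal, ← Matrix.diagonal_one]
    congr 1
    ext l
    by_cases h : l = j <;> simp [h]⟩

theorem phase_mulVec {d : ℕ} (j : Fin d) (z : Fin d → ℂ) (l : Fin d) :
    (phase j : Matrix (Fin d) (Fin d) ℂ).mulVec z l = (if l = j then Complex.I else 1) * z l := by
  by_cases h : l = j <;> simp [phase, Matrix.mulVec_diagonal, h]

/-- The rotation by the angle `θ` in the plane of the coordinates `i` and `j`. -/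
def rotation {d : ℕ} {i j : Fin d} (hij : i ≠ j) (θ : ℝ) : U d :=
  ⟨Matrix.of fun a b =>
      if a = i then Real.cos θ * (if b = i then 1 else 0) + Real.sin θ * (if b = j then 1 else 0)
      else if a = j then
        -Real.sin θ * (if b = i then 1 else 0) + Real.cos θ * (if b = j then 1 else 0)
      else if b = a then 1 else 0, by
    rw [Matrix.mem_unitaryGroup_iff]
    ext a b
    simp only [Matrix.mul_apply, Matrix.star_apply, Matrix.of_apply, Matrix.one_apply]
    by_cases ha : a = i <;> by_cases ha' : a = j <;> by_cases hb : b = i <;>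
      by_cases hb' : b = j <;> (try subst ha) <;> (try subst ha') <;> (try subst hb) <;>
      (try subst hb') <;>
      simp_all [mul_add, add_mul, Finset.sum_add_distrib, eq_comm]
    all_goals rw [← Complex.sin_conj, ← Complex.cos_conj, Complex.conj_ofReal]
    · linear_combination -Complex.sin_sq_add_cos_sq θ
    · ring
    · ring
    · linear_combination -Complex.sin_sq_add_cos_sq θ⟩

theorem rotation_mulVec {d : ℕ} {i j : Fin d} (hij : i ≠ j) (θ : ℝ) (z : Fin d → ℂ) (l : Fin d) :
    (rotation hij θ : Matrix (Fin d) (Fin d) ℂ).mulVec z l =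
      if l = i then Real.cos θ * z i + Real.sin θ * z j
      else if l = j then -Real.sin θ * z i + Real.cos θ * z j else z l := by
  simp only [rotation, Matrix.mulVec, dotProduct, Matrix.of_apply]
  split_ifs <;> simp [add_mul, Finset.sum_add_distrib]

/-- Compactness of `[-1, 1] × U d` bounds the derivative uniformly, which permits differentiation
under the integral. -/
theorem integral_deriv_eq_zero_of_integral_const {d : ℕ} {F F' : ℝ → U d → ℂ}
    (hF : Continuous fun p : ℝ × U d => F p.1 p.2) (hF' : Continuous fun p : ℝ × U d => F' p.1 p.2)
    (hderiv : ∀ u θ, HasDerivAt (fun θ => F θ u) (F' θ u) θ)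
    (hconst : ∀ θ, ∫ u, F θ u ∂haarU d = ∫ u, F 0 u ∂haarU d) : ∫ u, F' 0 u ∂haarU d = 0 := by
  obtain ⟨C, hC⟩ := ((isCompact_Icc (a := (-1 : ℝ)) (b := 1)).prod
    (isCompact_univ (X := U d))).exists_bound_of_continuousOn hF'.continuousOn
  have hFθ : ∀ θ, Continuous (F θ) := fun θ => hF.comp (Continuous.prodMk_right θ)
  have hF'θ : ∀ θ, Continuous (F' θ) := fun θ => hF'.comp (Continuous.prodMk_right θ)
  have h := (hasDerivAt_integral_of_dominated_loc_of_deriv_le (μ := haarU d)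
    (F := F) (F' := F') (x₀ := (0 : ℝ))
    (s := Set.Icc (-1) 1) (bound := fun _ => C) (Icc_mem_nhds (by norm_num) (by norm_num))
    (Filter.Eventually.of_forall fun θ => (hFθ θ).aestronglyMeasurable)
    ((hFθ 0).integrable_of_hasCompactSupport (HasCompactSupport.of_compactSpace _))
    (hF'θ 0).aestronglyMeasurable
    (Filter.Eventually.of_forall fun u θ hθ => hC (θ, u) ⟨hθ, Set.mem_univ _⟩)
    (integrable_const _) (Filter.Eventually.of_forall fun u θ _ => hderiv u θ)).2
  exact h.unique ((hasDerivAt_const (0 : ℝ) (∫ u, F 0 u ∂haarU d)).congr_of_eventuallyEq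
    (Filter.Eventually.of_forall hconst))

/-- `P` and `Q` stand for two coordinates under rotation of their plane. The truncated exponent `k -
1` is harmless at `k = 0`, where its coefficient vanishes. -/
theorem hasDerivAt_star_pow_mul {P Q : ℝ → ℂ} {θ : ℝ} (hP : HasDerivAt P (Q θ) θ)
    (hQ : HasDerivAt Q (-P θ) θ) (k : ℕ) :
    HasDerivAt (fun θ => star (P θ) ^ (k + 1) * (P θ ^ k * Q θ))
      ((k + 1) * (star (P θ) * P θ) ^ k * (star (Q θ) * Q θ) +
        star (P θ) ^ (k + 1) * (k * P θ ^ (k - 1)) * Q θ ^ 2 - (star (P θ) * P θ) ^ (k + 1)) θ := by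
  refine ((hP.star.fun_pow (k + 1)).fun_mul ((hP.fun_pow k).fun_mul hQ)).congr_deriv ?_
  simp only [Nat.cast_add, Nat.cast_one, Nat.add_sub_cancel]
  ring

/-- Differentiating the invariance of the Haar integral under the rotations of a plane. -/
theorem integral_deriv_rotation_eq_zero {d : ℕ} (x : Fin d → ℂ) {i j : Fin d} (hij : i ≠ j)
    (k : ℕ) :
    ∫ u, ((k + 1) * (star (orbitVec x u i) * orbitVec x u i) ^ k *
        (star (orbitVec x u j) * orbitVec x u j)
      + star (orbitVec x u i) ^ (k + 1) * (k * orbitVec x u i ^ (k - 1)) * orbitVec x u j ^ 2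
      - (star (orbitVec x u i) * orbitVec x u i) ^ (k + 1)) ∂haarU d = 0 := by
  obtain ⟨P, hPdef⟩ : ∃ P : ℝ → U d → ℂ, ∀ θ u,
      P θ u = Real.cos θ * orbitVec x u i + Real.sin θ * orbitVec x u j := ⟨_, fun _ _ => rfl⟩
  obtain ⟨Q, hQdef⟩ : ∃ Q : ℝ → U d → ℂ, ∀ θ u,
      Q θ u = -Real.sin θ * orbitVec x u i + Real.cos θ * orbitVec x u j := ⟨_, fun _ _ => rfl⟩
  have hP : ∀ u θ, HasDerivAt (fun θ => P θ u) (Q θ u) θ := fun u θ => by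
    simp only [hPdef, hQdef]
    exact (((Real.hasDerivAt_cos θ).ofReal_comp.mul_const _).fun_add
      ((Real.hasDerivAt_sin θ).ofReal_comp.mul_const _)).congr_deriv (by push_cast; rfl)
  have hQ : ∀ u θ, HasDerivAt (fun θ => Q θ u) (-P θ u) θ := fun u θ => by
    simp only [hPdef, hQdef]
    exact (((Real.hasDerivAt_sin θ).ofReal_comp.fun_neg.mul_const _).fun_add
      ((Real.hasDerivAt_cos θ).ofReal_comp.mul_const _)).congr_deriv (by push_cast; ring)
  have hz : ∀ l, Continuous fun p : ℝ × U d => orbitVec x p.2 l := fun l =>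
    (continuous_apply l).comp ((continuous_orbitVec x).comp continuous_snd)
  have hzi := hz i
  have hzj := hz j
  have hcP : Continuous fun p : ℝ × U d => P p.1 p.2 := by
    simp only [hPdef]
    fun_prop
  have hcQ : Continuous fun p : ℝ × U d => Q p.1 p.2 := by
    simp only [hQdef]
    fun_prop
  have h := integral_deriv_eq_zero_of_integral_const
    (F := fun θ u => star (P θ u) ^ (k + 1) * (P θ u ^ k * Q θ u))
    (by fun_prop) (by fun_prop) (fun u θ => hasDerivAt_star_pow_mul (hP u θ) (hQ u θ) k)
    fun θ => ?_
  · simpa [hPdef, hQdef] using h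
  · have h := integral_comp_mulVec_orbitVec x (rotation hij θ)
      fun z => star (z i) ^ (k + 1) * (z i ^ k * z j)
    simp only [rotation_mulVec, if_true, hij.symm, if_false] at h
    simpa [hPdef, hQdef] using h

/-- Multiplying `z_j` by `I` flips the sign of `z_j^2` and fixes `z_i`, so the integral equals its
own negative. -/
theorem integral_phase_eq_zero {d : ℕ} (x : Fin d → ℂ) {i j : Fin d} (hij : i ≠ j) (m n : ℕ) :
    ∫ u, star (orbitVec x u i) ^ m * (n * orbitVec x u i ^ (n - 1)) * orbitVec x u j ^ 2 ∂haarU d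
      = 0 := by
  have h := integral_comp_mulVec_orbitVec x (phase j)
    (fun z => star (z i) ^ m * (n * z i ^ (n - 1)) * z j ^ 2)
  simp only [phase_mulVec, hij, if_true, if_false, mul_pow, Complex.I_sq, one_mul, neg_mul,
    mul_neg, integral_neg] at h
  exact self_eq_neg.1 h.symm

theorem integral_norm_pow_mul {d : ℕ} (x : Fin d → ℂ) {i j : Fin d} (hij : i ≠ j) (k : ℕ) :
    (k + 1) * ∫ u, (‖orbitVec x u i‖ ^ 2) ^ k * ‖orbitVec x u j‖ ^ 2 ∂haarU d =
      ∫ u, (‖orbitVec x u i‖ ^ 2) ^ (k + 1) ∂haarU d := by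
  have h := integral_deriv_rotation_eq_zero x hij k
  simp only [← starRingEnd_apply, Complex.conj_mul'] at h
  simp only [starRingEnd_apply] at h
  rw [integral_sub (integrable_comp_orbitVec x
      (f := fun z => (k + 1) * (‖z i‖ ^ 2 : ℂ) ^ k * (‖z j‖ ^ 2 : ℂ)
      + star (z i) ^ (k + 1) * (k * z i ^ (k - 1)) * z j ^ 2) (by fun_prop))
      (integrable_comp_orbitVec x (f := fun z => (‖z i‖ ^ 2 : ℂ) ^ (k + 1)) (by fun_prop)),
    integral_add (integrable_comp_orbitVec x
      (f := fun z => (k + 1) * (‖z i‖ ^ 2 : ℂ) ^ k * (‖z j‖ ^ 2 : ℂ)) (by fun_prop))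
      (integrable_comp_orbitVec x
      (f := fun z => star (z i) ^ (k + 1) * (k * z i ^ (k - 1)) * z j ^ 2) (by fun_prop)),
    integral_phase_eq_zero x hij, add_zero, sub_eq_zero] at h
  simp only [mul_assoc, integral_const_mul] at h
  have h1 := integral_ofReal (𝕜 := ℂ) (μ := haarU d)
    (f := fun u => (‖orbitVec x u i‖ ^ 2) ^ k * ‖orbitVec x u j‖ ^ 2)
  have h2 := integral_ofReal (𝕜 := ℂ) (μ := haarU d)
    (f := fun u => (‖orbitVec x u i‖ ^ 2) ^ (k + 1))
  push_cast at h1 h2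
  simp at h1 h2
  rw [h1, h2] at h
  exact_mod_cast h

theorem integral_norm_pow_succ {d : ℕ} (x : Fin d → ℂ) (hx : ∑ i, ‖x i‖ ^ 2 = 1) (i : Fin d)
    (k : ℕ) :
    (d + k) * ∫ u, (‖orbitVec x u i‖ ^ 2) ^ (k + 1) ∂haarU d =
      (k + 1) * ∫ u, (‖orbitVec x u i‖ ^ 2) ^ k ∂haarU d := by
  have hnorm : ∀ u, ∑ j, ‖orbitVec x u j‖ ^ 2 = 1 := fun u => by
    have h := star_dotProduct_unitary_mulVec u x x
    rw [star_dotProduct_self, star_dotProduct_self, hx] at h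
    exact_mod_cast h
  have hsum : ∫ u, (‖orbitVec x u i‖ ^ 2) ^ k ∂haarU d =
      ∑ j, ∫ u, (‖orbitVec x u i‖ ^ 2) ^ k * ‖orbitVec x u j‖ ^ 2 ∂haarU d := by
    rw [← integral_finsetSum _ fun j _ => integrable_comp_orbitVec x
      (f := fun z => (‖z i‖ ^ 2) ^ k * ‖z j‖ ^ 2) (by fun_prop)]
    simp only [← Finset.mul_sum, hnorm, mul_one]
  -- The term `j = i` is the next moment itself; each of the other `d - 1` terms, times `k + 1`,
  -- equals it too.
  rw [hsum, ← Finset.add_sum_erase _ _ (Finset.mem_univ i), mul_add, Finset.mul_sum,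
    Finset.sum_congr rfl fun j hj => integral_norm_pow_mul x (Finset.ne_of_mem_erase hj).symm k,
    Finset.sum_const, Finset.card_erase_of_mem (Finset.mem_univ i), Finset.card_univ,
    Fintype.card_fin, nsmul_eq_mul, Nat.cast_pred (Fin.pos i)]
  simp only [← pow_succ]
  ring

theorem choose_mul_integral_norm_pow {d : ℕ} (x : Fin d → ℂ) (hx : ∑ i, ‖x i‖ ^ 2 = 1) (i : Fin d)
    (k : ℕ) :
    ((d + k - 1).choose k : ℝ) * ∫ u, (‖orbitVec x u i‖ ^ 2) ^ k ∂haarU d = 1 := by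
  induction k with
  | zero => simp
  | succ k ih =>
    have h1 : (d + (k + 1) - 1).choose (k + 1) * (k + 1) = (d + k - 1).choose k * (d + k) := by
      have hd := Fin.pos i
      have h := Nat.add_one_mul_choose_eq (d + k - 1) k
      rw [show d + k - 1 + 1 = d + k by omega] at h
      rw [show d + (k + 1) - 1 = d + k by omega, ← h, mul_comm]
    have h2 : ((d + (k + 1) - 1).choose (k + 1) : ℝ) * (k + 1) =
      (d + k - 1).choose k * (d + k) := by exact_mod_cast h1
    have h3 := integral_norm_pow_succ x hx i k
    refine mul_left_cancel₀ (show (k + 1 : ℝ) ≠ 0 by positivity) ?_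
    calc _ = ((d + (k + 1) - 1).choose (k + 1) * (k + 1)) *
          ∫ u, (‖orbitVec x u i‖ ^ 2) ^ (k + 1) ∂haarU d := by ring
      _ = (k + 1) * ((d + k - 1).choose k * ∫ u, (‖orbitVec x u i‖ ^ 2) ^ k ∂haarU d) := by
        rw [h2, mul_assoc, h3]; ring
      _ = (k + 1) * 1 := by rw [ih]

theorem exists_unitary_mulVec_single {d : ℕ} (i : Fin d) (y : Fin d → ℂ)
    (hy : ∑ i, ‖y i‖ ^ 2 = 1) :
    ∃ w : U d, (w : Matrix (Fin d) (Fin d) ℂ).mulVec (Pi.single i 1) = y := by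
  have hn : ‖WithLp.toLp 2 y‖ = 1 := by
    rw [EuclideanSpace.norm_eq, hy, Real.sqrt_one]
  obtain ⟨b, hb⟩ := Orthonormal.exists_orthonormalBasis_extension_of_card_eq (𝕜 := ℂ)
    (ι := Fin d) (E := EuclideanSpace ℂ (Fin d)) (by simp) (v := fun _ => WithLp.toLp 2 y)
    (s := {i}) (by
      rw [orthonormal_iff_ite]
      rintro ⟨a, rfl⟩ ⟨b, rfl⟩
      simp [hn])
  refine ⟨⟨_, (EuclideanSpace.basisFun (Fin d) ℂ).toMatrix_orthonormalBasis_mem_unitary b⟩, ?_⟩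
  ext l
  have := hb i rfl
  simp [Module.Basis.toMatrix_apply, this]

/-- With `w e_i = y`, replacing `u` by `w u` turns the overlap with `y` into the coordinate `i` of
`u x`. -/
theorem choose_mul_integral_norm_dotProduct_pow {d : ℕ} (k : ℕ) (x y : Fin d → ℂ)
    (hx : ∑ i, ‖x i‖ ^ 2 = 1) (hy : ∑ i, ‖y i‖ ^ 2 = 1) :
    ((d + k - 1).choose k : ℝ) *
      ∫ u : U d, ‖star y ⬝ᵥ (u : Matrix (Fin d) (Fin d) ℂ).mulVec x‖ ^ (2 * k) ∂haarU d = 1 := by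
  have hd : 0 < d := by
    rcases Nat.eq_zero_or_pos d with rfl | h
    · simp at hx
    · exact h
  let i : Fin d := ⟨0, hd⟩
  obtain ⟨w, hw⟩ := exists_unitary_mulVec_single i y hy
  rw [← choose_mul_integral_norm_pow x hx i k, ← integral_mul_left_eq_self _ w]
  congr 2
  ext u
  have : star y ⬝ᵥ ((w * u : U d) : Matrix (Fin d) (Fin d) ℂ).mulVec x = orbitVec x u i := by
    change star y ⬝ᵥ orbitVec x (w * u) = _
    rw [orbitVec_mul, ← hw, star_dotProduct_unitary_mulVec]
    simp
  rw [this, pow_mul]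

/-! ### The weight of a state in the orbit -/

theorem abs_sum_sub_integral_le {d k N : ℕ} {E : UnitaryEnsemble d N} {ε : ℝ} (hε : 0 ≤ ε)
    (hE : E.IsApproxDesign k ε) {x y : Fin d → ℂ} (hx : star x ⬝ᵥ x = 1) (hy : star y ⬝ᵥ y = 1) :
    |∑ i, E.p i * ‖star y ⬝ᵥ (E.u i : Matrix (Fin d) (Fin d) ℂ).mulVec x‖ ^ (2 * k) -
      ∫ u : U d, ‖star y ⬝ᵥ (u : Matrix (Fin d) (Fin d) ℂ).mulVec x‖ ^ (2 * k) ∂haarU d| ≤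
      (k ! : ℝ) / (d : ℝ) ^ (2 * k) * ε := by
  have h := (norm_dotProduct_mulVec_le_diamondNorm (E.twirl k - haarTwirl d k) (vecPow k x)
    (vecPow k y) (by rw [star_vecPow_dotProduct_vecPow, hx, one_pow])
    (by rw [star_vecPow_dotProduct_vecPow, hy, one_pow])).trans hE
  rwa [LinearMap.sub_apply, Matrix.sub_mulVec, dotProduct_sub, dotProduct_twirl_mulVec,
    dotProduct_haarTwirl_mulVec, ← Complex.ofReal_sub, Complex.norm_real, Real.norm_eq_abs,
    ENNReal.ofReal_le_ofReal_iff (by positivity)] at h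

theorem norm_dotProduct_eq_one_of_pureState_eq {d : ℕ} {v w : Fin d → ℂ} (hv : star v ⬝ᵥ v = 1)
    (h : pureState w = pureState v) : ‖star v ⬝ᵥ w‖ = 1 := by
  have h1 := dotProduct_vecMulVec_star_mulVec v w
  have h2 := dotProduct_vecMulVec_star_mulVec v v
  unfold pureState at h
  rw [h, h2, hv, norm_one, one_pow, Complex.ofReal_inj] at h1
  exact (pow_eq_one_iff_of_nonneg (norm_nonneg _) two_ne_zero).1 h1.symm

theorem orbitWeight_le_sum {d N : ℕ} (E : UnitaryEnsemble d N) (x : EuclideanSpace ℂ (Fin d))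
    (k : ℕ) {y : Fin d → ℂ} (hy : star y ⬝ᵥ y = 1) :
    E.orbitWeight x (pureState y) ≤
      ∑ i, E.p i * ‖star y ⬝ᵥ (E.u i : Matrix (Fin d) (Fin d) ℂ).mulVec x.ofLp‖ ^ (2 * k) := by
  classical
  rw [UnitaryEnsemble.orbitWeight, Finset.sum_filter]
  refine Finset.sum_le_sum fun i _ => ?_
  split_ifs with h
  · rw [norm_dotProduct_eq_one_of_pureState_eq hy h, one_pow, mul_one]
  · exact mul_nonneg (E.p_nonneg i) (by positivity)

theorem sum_orbitWeight {d N : ℕ} (E : UnitaryEnsemble d N) (x : EuclideanSpace ℂ (Fin d)) :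
    ∑ ρ ∈ E.orbitStates x, E.orbitWeight x ρ = 1 := by
  classical
  rw [← E.p_sum]
  unfold UnitaryEnsemble.orbitWeight
  convert Finset.sum_fiberwise_of_maps_to (s := Finset.univ) (t := E.orbitStates x)
    (g := E.orbitState x) (fun i _ => by simp [UnitaryEnsemble.orbitStates]) E.p

theorem orbitWeight_le {d k N : ℕ} (hk : k ≤ d ^ 2) {ε : ℝ} (hε : 0 ≤ ε)
    {E : UnitaryEnsemble d N} (hE : E.IsApproxDesign k ε) {x : EuclideanSpace ℂ (Fin d)}
    (hx : ‖x‖ = 1) {ρ : Matrix (Fin d) (Fin d) ℂ} (hρ : ρ ∈ E.orbitStates x) :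
    E.orbitWeight x ρ ≤ (1 + ε) / ((d + k - 1).choose k : ℝ) := by
  obtain ⟨i, rfl⟩ : ∃ i, E.orbitState x i = ρ := by simpa [UnitaryEnsemble.orbitStates] using hρ
  have hx' : ∑ i, ‖x i‖ ^ 2 = 1 := by rw [← EuclideanSpace.norm_sq_eq, hx, one_pow]
  have hxx : star x.ofLp ⬝ᵥ x.ofLp = 1 := by rw [star_dotProduct_self, hx', Complex.ofReal_one]
  set y := (E.u i : Matrix (Fin d) (Fin d) ℂ).mulVec x.ofLp with hy
  have hyy : star y ⬝ᵥ y = 1 := by rw [hy, star_dotProduct_unitary_mulVec, hxx]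
  have hy' : ∑ i, ‖y i‖ ^ 2 = 1 := by
    rw [star_dotProduct_self] at hyy
    exact_mod_cast hyy
  have hmoment := choose_mul_integral_norm_dotProduct_pow k x.ofLp y hx' hy'
  have hdesign := (abs_le.1 (abs_sum_sub_integral_le hε hE hxx hyy)).2
  have hweight := orbitWeight_le_sum E x k hyy
  have hd : 0 < d := by
    rcases Nat.eq_zero_or_pos d with rfl | h
    · simp at hx'
    · exact h
  have hD : (0 : ℝ) < (d + k - 1).choose k := by
    exact_mod_cast Nat.choose_pos (show k ≤ d + k - 1 by omega)
  have hfac : (k ! : ℝ) / (d : ℝ) ^ (2 * k) ≤ 1 / ((d + k - 1).choose k : ℝ) := by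
    rw [div_le_div_iff₀ (by positivity) hD, one_mul]
    exact_mod_cast factorial_mul_choose_le hk
  rw [mul_comm, ← eq_div_iff hD.ne'] at hmoment
  rw [hmoment] at hdesign
  have h := mul_le_mul_of_nonneg_right hfac hε
  change E.orbitWeight x (pureState y) ≤ _
  rw [add_div, ← one_div_mul_eq_div _ ε]
  linarith

end QuantumDesign

end

theorem mainTheorem7 (d k N : ℕ) (hk : k ≤ d ^ 2) (ε : ℝ) (hε : 0 < ε)
    (E : QuantumDesign.UnitaryEnsemble d N) (hE : E.IsApproxDesign k ε)
    (x : EuclideanSpace ℂ (Fin d)) (hx : ‖x‖ = 1) :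
    (∀ ρ ∈ E.orbitStates x, E.orbitWeight x ρ ≤ (1 + ε) / ((d + k - 1).choose k : ℝ)) ∧
      ((d + k - 1).choose k : ℝ) / (1 + ε) ≤ ((E.orbitStates x).card : ℝ) := by
  have hle : ∀ ρ ∈ E.orbitStates x, E.orbitWeight x ρ ≤ (1 + ε) / ((d + k - 1).choose k : ℝ) :=
    fun ρ hρ => QuantumDesign.orbitWeight_le hk hε.le hE hx hρ
  refine ⟨hle, ?_⟩
  have hsum := Finset.sum_le_card_nsmul _ _ _ hle
  rw [QuantumDesign.sum_orbitWeight, nsmul_eq_mul] at hsum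
  -- A unit vector forces `d > 0`, so the binomial is never zero; that case is trivial anyway.
  rcases (Nat.cast_nonneg (α := ℝ) ((d + k - 1).choose k)).eq_or_lt with h0 | hD
  · rw [← h0, zero_div]
    positivity
  · rw [div_le_iff₀ (by positivity)]
    rwa [mul_div_assoc', le_div_iff₀ hD, one_mul] at hsum
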